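/- All Banach spaces are real. A *standard inverse system* is a sequence of finite dimensional Banach spaces $W_1, W_2, \dots$ with linear maps $\theta_i : W_{i+1}\to W_i$ of norm $\le 1$. Its inverse limit $\varprojlim W_i$ is the space of all sequences $(w_i)\in\prod_i W_i$ with $\theta_i(w_{i+1})=w_i$ for all $i$ and $\sup_i\|w_i\|<\infty$, with the norm $\|(w_i)\|=\lim_{j\to\infty}\|w_j\|$; $\pi_j:\varprojlim W_i\to W_j$ is the projection $(w_i)\mapsto w_j$. A *quotient map* of normed spaces is a surjective bounded linear map $q:E\to F$ such that $\|y\|=\inf\{\|x\| : q(x)=y\}$ for every $y\in F$. Let $V\subset\varprojlim W_i$ be a closed linear subspace. The pair $(\varprojlim W_i,V)$ has the *Determining Property* if a sequence $(v_k)$ in $V$ converges in norm whenever $(\pi_j(v_k))_k$ converges in $W_j$ for every $j$, $(\|v_k\|)_k$ is bounded, and $\|\pi_j(v_k)\|\to\|v_k\|$ as $j\to\infty$, uniformly in $k$. It is a *GFDA* (good finite dimensional approximation) of $V$ if it has the Determining Property and the restriction $\pi_i|_V:V\to W_i$ is a quotient map for every $i$. A Banach space *admits a GFDA* if it is linearly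 isometric to such a $V$. A *separable dual space* is a separable Banach space that is linearly isometric to the dual of a Banach space; "isomorphic" means linearly homeomorphic. 1. If $(\varprojlim W_i,V)$ is a GFDA, then $V=\varprojlim W_i$, and $V$ is a separable dual space. 2. Every separable dual space is isomorphic to a Banach space that admits a GFDA. 3. Consequently, a Banach space is isomorphic to a Banach space that admits a GFDA if and only if it is isomorphic to a separable dual space. -/

import Mathlib

open Filter Topology

universe u

/-- A standard inverse system `W 0 ← W 1 ← W 2 ← ⋯`: finite dimensional real Banach spaces,
with bonding maps that are linear of norm at most one. -/
structure StandardInverseSystem where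
  W : ℕ → Type u
  [normed : ∀ i, NormedAddCommGroup (W i)]
  [space : ∀ i, NormedSpace ℝ (W i)]
  [finDim : ∀ i, FiniteDimensional ℝ (W i)]
  bond : ∀ i, W (i + 1) →L[ℝ] W i
  norm_bond_le : ∀ i, ‖bond i‖ ≤ 1

namespace StandardInverseSystem

attribute [instance] normed space finDim

variable (S : StandardInverseSystem.{u})

/-- The norm-bounded sequences `(w i)` that are compatible with the bonding maps. -/
def boundedThreads : Submodule ℝ (∀ i, S.W i) where
  carrier := {w | (∀ i, S.bond i (w (i + 1)) = w i) ∧ ∃ C : ℝ, ∀ i, ‖w i‖ ≤ C}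
  add_mem' := by
    rintro a b ⟨ha, A, hA⟩ ⟨hb, B, hB⟩
    refine ⟨fun i => by simp [ha, hb], A + B, fun i => ?_⟩
    exact (norm_add_le _ _).trans (add_le_add (hA i) (hB i))
  zero_mem' := ⟨fun i => by simp, 0, fun i => by simp⟩
  smul_mem' := by
    rintro c a ⟨ha, A, hA⟩
    refine ⟨fun i => by simp [ha], ‖c‖ * A, fun i => ?_⟩
    simpa [norm_smul] using mul_le_mul_of_nonneg_left (hA i) (norm_nonneg c)

/-- The inverse limit of a standard inverse system. It is a type of its own, so that its
topology is the one of the limit norm below and not the product topology. -/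
def InvLim : Type u := S.boundedThreads

namespace InvLim

instance : AddCommGroup S.InvLim := inferInstanceAs (AddCommGroup S.boundedThreads)
instance : Module ℝ S.InvLim := inferInstanceAs (Module ℝ S.boundedThreads)

variable {S}

/-- The `j`-th entry of a compatible sequence. -/
def entry (w : S.InvLim) (j : ℕ) : S.W j := Subtype.val (p := (· ∈ S.boundedThreads)) w j

theorem bond_entry (w : S.InvLim) (j : ℕ) : S.bond j (w.entry (j + 1)) = w.entry j :=
  (Subtype.prop (p := (· ∈ S.boundedThreads)) w).1 j

theorem bounded_entry (w : S.InvLim) : ∃ C : ℝ, ∀ i, ‖w.entry i‖ ≤ C :=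
  (Subtype.prop (p := (· ∈ S.boundedThreads)) w).2

theorem entry_add (v w : S.InvLim) (j : ℕ) : (v + w).entry j = v.entry j + w.entry j := rfl

theorem entry_smul (c : ℝ) (w : S.InvLim) (j : ℕ) : (c • w).entry j = c • w.entry j := rfl

theorem ext_entry {v w : S.InvLim} (h : ∀ j, v.entry j = w.entry j) : v = w :=
  Subtype.ext (funext h)

theorem monotone_norm_entry (w : S.InvLim) : Monotone fun j => ‖w.entry j‖ :=
  monotone_nat_of_le_succ fun j => by
    have h := (S.bond j).le_of_opNorm_le (S.norm_bond_le j) (w.entry (j + 1))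
    rwa [bond_entry, one_mul] at h

/-- The norm of the inverse limit: the limit of the norms of the entries. -/
noncomputable instance : Norm S.InvLim := ⟨fun w => limUnder atTop fun j => ‖w.entry j‖⟩

theorem tendsto_norm_entry (w : S.InvLim) :
    Tendsto (fun j => ‖w.entry j‖) atTop (𝓝 ‖w‖) := by
  obtain ⟨C, hC⟩ := w.bounded_entry
  exact tendsto_nhds_limUnder
    ⟨_, tendsto_atTop_ciSup w.monotone_norm_entry ⟨C, by rintro _ ⟨j, rfl⟩; exact hC j⟩⟩

theorem norm_entry_le (w : S.InvLim) (j : ℕ) : ‖w.entry j‖ ≤ ‖w‖ :=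
  w.monotone_norm_entry.ge_of_tendsto w.tendsto_norm_entry j

theorem core : NormedSpace.Core ℝ S.InvLim where
  norm_nonneg w := (norm_nonneg _).trans (w.norm_entry_le 0)
  norm_smul c w := by
    refine tendsto_nhds_unique (c • w).tendsto_norm_entry ?_
    simpa only [entry_smul, norm_smul] using w.tendsto_norm_entry.const_mul ‖c‖
  norm_triangle v w := by
    refine le_of_tendsto_of_tendsto' (v + w).tendsto_norm_entry
      (v.tendsto_norm_entry.add w.tendsto_norm_entry) fun j => ?_
    rw [entry_add]
    exact norm_add_le _ _
  norm_eq_zero_iff w := by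
    constructor
    · intro h
      refine ext_entry fun j => ?_
      exact norm_le_zero_iff.mp ((w.norm_entry_le j).trans h.le)
    · rintro rfl
      refine tendsto_nhds_unique (tendsto_norm_entry (0 : S.InvLim)) ?_
      have h : (fun j => ‖(0 : S.InvLim).entry j‖) = fun _ => (0 : ℝ) :=
        funext fun j => norm_zero (E := S.W j)
      rw [h]
      exact tendsto_const_nhds

noncomputable instance : NormedAddCommGroup S.InvLim := NormedAddCommGroup.ofCore core
noncomputable instance : NormedSpace ℝ S.InvLim := NormedSpace.ofCore core

end InvLim

/-- The projection of the inverse limit to its `j`-th space. -/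
noncomputable def proj (j : ℕ) : S.InvLim →L[ℝ] S.W j :=
  LinearMap.mkContinuous
    { toFun := fun w => w.entry j
      map_add' := fun _ _ => rfl
      map_smul' := fun _ _ => rfl } 1
    fun w => (w.norm_entry_le j).trans (one_mul _).ge

theorem proj_apply (j : ℕ) (w : S.InvLim) : S.proj j w = w.entry j := rfl

/-- The Determining Property of the pair `(lim W i, V)`: a norm-bounded sequence in `V`, all of
whose projections converge, and for which `‖π j (v k)‖ → ‖v k‖` as `j → ∞` uniformly in `k`,
converges in norm. -/
def DeterminingProperty (V : Submodule ℝ S.InvLim) : Prop :=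
  ∀ v : ℕ → S.InvLim, (∀ k, v k ∈ V) →
    (∀ j, ∃ w : S.W j, Tendsto (fun k => S.proj j (v k)) atTop (𝓝 w)) →
    (∃ C : ℝ, ∀ k, ‖v k‖ ≤ C) →
    TendstoUniformly (fun j k => ‖S.proj j (v k)‖) (fun k => ‖v k‖) atTop →
    ∃ x : S.InvLim, Tendsto v atTop (𝓝 x)

end StandardInverseSystem

/-- A quotient map of normed spaces: a surjective linear map for which the norm of the target is
the quotient norm. -/
def IsNormQuotientMap {E F : Type*} [NormedAddCommGroup E] [NormedSpace ℝ E]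
    [NormedAddCommGroup F] [NormedSpace ℝ F] (q : E →L[ℝ] F) : Prop :=
  Function.Surjective q ∧ ∀ y : F, IsGLB {r : ℝ | ∃ x : E, q x = y ∧ ‖x‖ = r} ‖y‖

/-- `(lim W i, V)` is a good finite dimensional approximation (GFDA) of the closed subspace `V`:
it has the Determining Property, and each projection restricts to a quotient map on `V`. -/
structure IsGFDA (S : StandardInverseSystem.{u}) (V : Submodule ℝ S.InvLim) : Prop where
  isClosed : IsClosed (V : Set S.InvLim)
  determining : S.DeterminingProperty V
  isNormQuotientMap : ∀ i, IsNormQuotientMap ((S.proj i).comp V.subtypeL)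

/-- The normed space `U` admits a GFDA: up to a linear isometry, it is a subspace `V` of an inverse
limit such that `(lim W i, V)` is a GFDA. -/
def AdmitsGFDA (U : Type u) [NormedAddCommGroup U] [NormedSpace ℝ U] : Prop :=
  ∃ (S : StandardInverseSystem.{u}) (V : Submodule ℝ S.InvLim),
    IsGFDA S V ∧ Nonempty (U ≃ₗᵢ[ℝ] V)

/-- `U` is a separable dual space: it is separable, and linearly isometric to the dual of a
Banach space. -/
def IsSeparableDualSpace (U : Type u) [NormedAddCommGroup U] [NormedSpace ℝ U] : Prop :=
  TopologicalSpace.SeparableSpace U ∧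
    ∃ (X : Type u) (_ : NormedAddCommGroup X) (_ : NormedSpace ℝ X) (_ : CompleteSpace X),
      Nonempty (U ≃ₗᵢ[ℝ] StrongDual ℝ X)

/-! From a GFDA to a separable dual: every inverse limit is a dual space. Its predual is the norm
closure of the functionals that factor through some `W i`, and `equivPredualDual` rests on the
reflexivity of finite dimensional spaces. The Determining Property does the rest. Near-minimal lifts
of the entries of a thread converge to that thread, so the closed subspace is everything
(`IsGFDA.eq_top`). Coding each vector by its entries, its norm and its rate of norm approximation
embeds `V` as a set in a separable metrizable space, and decoding is continuous
(`DeterminingProperty.separableSpace`).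

From a separable dual to a GFDA: choose finite dimensional `F n`, with `F 0 = 0`, that come
arbitrarily close to every functional, and renorm by `∑ 2⁻ⁿ d(f, F n)`. Each distance is weak* lower
semicontinuous on bounded families, so convergence of the sums forces convergence of each distance;
and close to a finite dimensional space, bounded weak* convergence is norm convergence up to a small
error. This gives the Kadec-Klee property (`tendsto_of_tendsto_distSumSeminorm`). The quotients by
annihilators of finitely many predual vectors then form a GFDA (`admitsGFDA_of_kadecKlee`):
uniformity in the Determining Property yields convergence of norms, which Kadec-Klee upgrades to
norm convergence. -/

namespace StandardInverseSystem

variable {S : StandardInverseSystem.{u}}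

/-! ### Consequences of the Determining Property -/

theorem InvLim.tendsto_entry {ι : Type*} {l : Filter ι} {v : ι → S.InvLim} {x : S.InvLim}
    (h : Tendsto v l (𝓝 x)) (j : ℕ) : Tendsto (fun k => (v k).entry j) l (𝓝 (x.entry j)) :=
  ((S.proj j).continuous.tendsto x).comp h

/-- Under the Determining Property, the limit is the thread of the limits of the projections. -/
theorem DeterminingProperty.tendsto {V : Submodule ℝ S.InvLim} (h : S.DeterminingProperty V)
    {v : ℕ → S.InvLim} (hv : ∀ k, v k ∈ V) {x : S.InvLim}
    (hx : ∀ j, Tendsto (fun k => (v k).entry j) atTop (𝓝 (x.entry j)))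
    (hb : ∃ C : ℝ, ∀ k, ‖v k‖ ≤ C)
    (hu : ∀ ε > 0, ∃ J, ∀ j ≥ J, ∀ k, ‖v k‖ - ‖(v k).entry j‖ < ε) :
    Tendsto v atTop (𝓝 x) := by
  have hu' : TendstoUniformly (fun j k => ‖S.proj j (v k)‖) (fun k => ‖v k‖) atTop := by
    rw [Metric.tendstoUniformly_iff]
    intro ε hε
    obtain ⟨J, hJ⟩ := hu ε hε
    filter_upwards [eventually_ge_atTop J] with j hj k
    rw [Real.dist_eq, proj_apply, abs_of_nonneg (sub_nonneg.2 ((v k).norm_entry_le j))]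
    exact hJ j hj k
  obtain ⟨y, hy⟩ := h v hv (fun j => ⟨_, hx j⟩) hb hu'
  have : y = x := InvLim.ext_entry fun j =>
    tendsto_nhds_unique (InvLim.tendsto_entry hy j) (hx j)
  exact this ▸ hy

/-- A good finite dimensional approximation exhausts the inverse limit. -/
theorem _root_.IsGFDA.eq_top {V : Submodule ℝ S.InvLim} (h : IsGFDA S V) : V = ⊤ := by
  rw [eq_top_iff]
  rintro w -
  have hlift : ∀ k : ℕ, ∃ x : V, S.proj k x = w.entry k ∧
      ‖x‖ < ‖w.entry k‖ + 1 / ((k : ℝ) + 1) := by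
    intro k
    obtain ⟨r, ⟨x, hx, rfl⟩, -, hr⟩ := ((h.isNormQuotientMap k).2 (w.entry k)).exists_between
      (lt_add_of_pos_right ‖w.entry k‖ (Nat.one_div_pos_of_nat (n := k)))
    exact ⟨x, hx, hr⟩
  choose x hx hxn using hlift
  have hentry : ∀ {j k : ℕ}, j ≤ k → ((x k : S.InvLim)).entry j = w.entry j := by
    intro j k hjk
    induction hjk using Nat.decreasingInduction with
    | self => exact hx k
    | of_succ i _ ih => rw [← InvLim.bond_entry, ih, InvLim.bond_entry]
  have hone : ∀ k : ℕ, 1 / ((k : ℝ) + 1) ≤ 1 := fun k => by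
    rw [div_le_one (by positivity)]
    exact le_add_of_nonneg_left k.cast_nonneg
  have hlim : Tendsto (fun k => (x k : S.InvLim)) atTop (𝓝 w) := by
    refine h.determining.tendsto (fun k => (x k).2) (fun j => ?_) ⟨‖w‖ + 1, fun k => ?_⟩ ?_
    · refine tendsto_const_nhds.congr' ?_
      filter_upwards [eventually_ge_atTop j] with k hk
      exact (hentry hk).symm
    · exact (hxn k).le.trans (add_le_add (w.norm_entry_le k) (hone k))
    · intro ε hε
      obtain ⟨K₁, hK₁⟩ := exists_nat_one_div_lt (half_pos hε)
      obtain ⟨K₂, hK₂⟩ := (w.tendsto_norm_entry.eventually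
        (lt_mem_nhds (sub_lt_self ‖w‖ (half_pos hε)))).exists_forall_of_atTop
      -- The finitely many small `k` are treated one by one. For larger `k`, the norm of `x k` is
      -- below `‖w‖ + ε / 2`, while its entry `K₂`, shared with `w`, already has norm above `‖w‖ - ε
      -- / 2`.
      have hfin : ∀ᶠ j in atTop, ∀ k < max K₁ K₂,
          ‖(x k : S.InvLim)‖ - ‖(x k : S.InvLim).entry j‖ < ε := by
        refine (eventually_all_finite (Set.finite_Iio (max K₁ K₂))).2 ?_
        intro k _
        filter_upwards [(x k : S.InvLim).tendsto_norm_entry.eventually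
          (lt_mem_nhds (sub_lt_self _ hε))] with j hj
        linarith
      obtain ⟨J, hJ⟩ := hfin.exists_forall_of_atTop
      refine ⟨max J K₂, fun j hj k => ?_⟩
      rcases lt_or_ge k (max K₁ K₂) with hk | hk
      · exact hJ j ((le_max_left _ _).trans hj) k hk
      · have hk1 : 1 / ((k : ℝ) + 1) ≤ 1 / ((K₁ : ℝ) + 1) :=
          Nat.one_div_le_one_div ((le_max_left _ _).trans hk)
        have h1 : ‖(x k : S.InvLim)‖ < ‖w.entry k‖ + 1 / ((k : ℝ) + 1) := hxn k
        have h2 : ‖w.entry K₂‖ ≤ ‖(x k : S.InvLim).entry j‖ := by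
          rw [← hentry ((le_max_right _ _).trans hk)]
          exact (x k : S.InvLim).monotone_norm_entry ((le_max_right _ _).trans hj)
        have h3 := hK₂ K₂ le_rfl
        have h4 := w.norm_entry_le k
        linarith
  exact h.isClosed.mem_of_tendsto hlim (Eventually.of_forall fun k => (x k).2)

/-- The Determining Property forces separability. -/
theorem DeterminingProperty.separableSpace {V : Submodule ℝ S.InvLim}
    (h : S.DeterminingProperty V) : TopologicalSpace.SeparableSpace V := by
  have hN : ∀ (v : S.InvLim) (m : ℕ), ∃ j, ‖v‖ - ‖v.entry j‖ < 1 / ((m : ℝ) + 1) := by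
    intro v m
    obtain ⟨j, hj⟩ := (v.tendsto_norm_entry.eventually
      (lt_mem_nhds (sub_lt_self ‖v‖ (Nat.one_div_pos_of_nat (n := m))))).exists
    exact ⟨j, by linarith⟩
  choose N hN using hN
  have (j : ℕ) : ProperSpace (S.W j) := FiniteDimensional.proper_real _
  -- `N` is an arbitrary choice, so `Φ` need not be continuous; only its inverse `g` on the range
  -- has to be.
  let Φ : V → (∀ j, S.W j) × ℝ × (ℕ → ℕ) := fun v => (fun j => v.1.entry j, ‖v.1‖, N v.1)
  let g : Set.range Φ → V := fun t => t.2.choose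
  have hg : ∀ t, Φ (g t) = t.1 := fun t => t.2.choose_spec
  have hsurj : Function.Surjective g := fun v => ⟨⟨Φ v, v, rfl⟩, Subtype.ext <|
    InvLim.ext_entry fun j => congrFun (congrArg Prod.fst (hg ⟨Φ v, v, rfl⟩)) j⟩
  have hcont : Continuous g := by
    rw [continuous_iff_seqContinuous]
    intro t t₀ ht
    have hΦ : Tendsto (fun k => Φ (g (t k))) atTop (𝓝 (Φ (g t₀))) := by
      simp only [hg]
      exact (continuous_subtype_val.tendsto t₀).comp ht
    obtain ⟨h1, h23⟩ := (Prod.tendsto_iff _ _).1 hΦ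
    obtain ⟨h2, h3⟩ := (Prod.tendsto_iff _ _).1 h23
    rw [tendsto_pi_nhds] at h1 h3
    obtain ⟨C, hC⟩ := h2.bddAbove_range
    rw [tendsto_subtype_rng]
    refine h.tendsto (fun k => (g (t k)).2) h1 ⟨C, fun k => hC ⟨k, rfl⟩⟩ fun ε hε => ?_
    obtain ⟨m, hm⟩ := exists_nat_one_div_lt hε
    -- A convergent sequence of naturals is bounded; this is the uniformity in `k`.
    obtain ⟨J, hJ⟩ := (h3 m).bddAbove_range
    refine ⟨J, fun j hj k => ?_⟩
    have h4 : N (g (t k)) m ≤ j := (hJ ⟨k, rfl⟩).trans hj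
    have h5 := (g (t k)).1.monotone_norm_entry h4
    have h6 := hN (g (t k)) m
    simp only at h5
    linarith
  exact hsurj.denseRange.separableSpace hcont

end StandardInverseSystem

/-! ### The predual of an inverse limit -/

/-- A finite dimensional space is reflexive. -/
theorem FiniteDimensional.inclusionInDoubleDual_surjective (E : Type*) [NormedAddCommGroup E]
    [NormedSpace ℝ E] [FiniteDimensional ℝ E] :
    Function.Surjective (NormedSpace.inclusionInDoubleDual ℝ E) := by
  intro φ
  let ψ : Module.Dual ℝ (Module.Dual ℝ E) :=
    φ.toLinearMap ∘ₗ (LinearMap.toContinuousLinearMap : _ ≃ₗ[ℝ] StrongDual ℝ E).toLinearMap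
  refine ⟨(Module.evalEquiv ℝ E).symm ψ, ContinuousLinearMap.ext fun f => ?_⟩
  have h : f.toLinearMap ((Module.evalEquiv ℝ E).symm ψ) = ψ f.toLinearMap :=
    Module.apply_evalEquiv_symm_apply ℝ E f.toLinearMap ψ
  have h' : ψ f.toLinearMap = φ f := rfl
  rw [NormedSpace.dual_def, ← h', ← h]
  rfl

namespace StandardInverseSystem

variable (S : StandardInverseSystem.{u})

/-- The functionals on the inverse limit that factor through one of the projections. -/
noncomputable def finiteStageDual : Submodule ℝ (StrongDual ℝ S.InvLim) :=
  ⨆ i, LinearMap.range (ContinuousLinearMap.precomp ℝ (S.proj i)).toLinearMap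

/-- A predual of the inverse limit: the closure of the functionals of the finite stages. -/
def Predual : Type u := S.finiteStageDual.topologicalClosure

noncomputable instance : NormedAddCommGroup S.Predual :=
  inferInstanceAs (NormedAddCommGroup S.finiteStageDual.topologicalClosure)

noncomputable instance : NormedSpace ℝ S.Predual :=
  inferInstanceAs (NormedSpace ℝ S.finiteStageDual.topologicalClosure)

instance : CompleteSpace S.Predual :=
  S.finiteStageDual.isClosed_topologicalClosure.completeSpace_coe

/-- The inclusion of the predual in the dual of the inverse limit. -/
noncomputable def predualIncl : S.Predual →ₗᵢ[ℝ] StrongDual ℝ S.InvLim :=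
  S.finiteStageDual.topologicalClosure.subtypeₗᵢ

/-- The transpose of the `i`-th projection, with values in the predual. -/
noncomputable def predualEmbed (i : ℕ) : StrongDual ℝ (S.W i) →L[ℝ] S.Predual :=
  (ContinuousLinearMap.precomp ℝ (S.proj i)).codRestrict S.finiteStageDual.topologicalClosure
    fun f => S.finiteStageDual.le_topologicalClosure
      (Submodule.mem_iSup_of_mem i (LinearMap.mem_range_self _ f))

theorem predualIncl_predualEmbed (i : ℕ) (f : StrongDual ℝ (S.W i)) :
    S.predualIncl (S.predualEmbed i f) = f.comp (S.proj i) := rfl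

/-- Threads commute with the bonding maps. This is what makes the vectors representing a functional
on the predual a thread. -/
theorem predualEmbed_bond (i : ℕ) (f : StrongDual ℝ (S.W i)) :
    S.predualEmbed (i + 1) (f.comp (S.bond i)) = S.predualEmbed i f := by
  refine S.predualIncl.injective (ContinuousLinearMap.ext fun v => ?_)
  simp only [predualIncl_predualEmbed, ContinuousLinearMap.comp_apply, proj_apply,
    InvLim.bond_entry]

theorem norm_predualEmbed_apply_le (i : ℕ) (f : StrongDual ℝ (S.W i)) :
    ‖S.predualEmbed i f‖ ≤ ‖f‖ := by
  rw [← S.predualIncl.norm_map, predualIncl_predualEmbed]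
  refine ContinuousLinearMap.opNorm_le_bound _ (norm_nonneg f) fun v => ?_
  exact (f.le_opNorm _).trans (mul_le_mul_of_nonneg_left (v.norm_entry_le i) (norm_nonneg f))

/-- Two functionals on the predual that agree on every finite stage are equal. -/
theorem predual_dual_ext {φ ψ : StrongDual ℝ S.Predual}
    (h : ∀ i f, φ (S.predualEmbed i f) = ψ (S.predualEmbed i f)) : φ = ψ := by
  have hM : ∀ x (hx : x ∈ S.finiteStageDual),
      φ ⟨x, S.finiteStageDual.le_topologicalClosure hx⟩ =
        ψ ⟨x, S.finiteStageDual.le_topologicalClosure hx⟩ := by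
    intro x hx
    induction hx using Submodule.iSup_induction' with
    | mem i x hx =>
      obtain ⟨f, rfl⟩ := hx
      exact h i f
    | zero => exact (map_zero φ).trans (map_zero ψ).symm
    | add x y hx hy ihx ihy =>
      exact (map_add φ ⟨x, _⟩ ⟨y, _⟩).trans
        ((congrArg₂ (· + ·) ihx ihy).trans (map_add ψ ⟨x, _⟩ ⟨y, _⟩).symm)
  refine ContinuousLinearMap.ext fun x => ?_
  obtain ⟨y, hy, hyx⟩ := mem_closure_iff_seq_limit.1 x.2
  let z : ℕ → S.Predual := fun n => ⟨y n, S.finiteStageDual.le_topologicalClosure (hy n)⟩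
  have hz : Tendsto z atTop (𝓝 x) := tendsto_subtype_rng.2 hyx
  refine tendsto_nhds_unique ((φ.continuous.tendsto x).comp hz) ?_
  refine ((ψ.continuous.tendsto x).comp hz).congr fun n => ?_
  exact (hM (y n) (hy n)).symm

/-- The evaluation map from the inverse limit to the dual of the predual. -/
noncomputable def toPredualDual : S.InvLim →ₗᵢ[ℝ] StrongDual ℝ S.Predual where
  toLinearMap := ((ContinuousLinearMap.precomp ℝ S.predualIncl.toContinuousLinearMap).comp
    (NormedSpace.inclusionInDoubleDual ℝ S.InvLim)).toLinearMap
  norm_map' v := by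
    refine le_antisymm (ContinuousLinearMap.opNorm_le_bound _ (norm_nonneg v) fun x => ?_) ?_
    · exact ((S.predualIncl x).le_opNorm v).trans (mul_comm _ _).le
    · refine le_of_tendsto' v.tendsto_norm_entry fun j => ?_
      obtain ⟨f, hf, hfv⟩ := exists_dual_vector'' ℝ (v.entry j)
      set J : StrongDual ℝ S.Predual :=
        ((ContinuousLinearMap.precomp ℝ S.predualIncl.toContinuousLinearMap).comp
          (NormedSpace.inclusionInDoubleDual ℝ S.InvLim)).toLinearMap v
      have h1 : J (S.predualEmbed j f) = ‖v.entry j‖ := hfv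
      calc ‖v.entry j‖ ≤ ‖J (S.predualEmbed j f)‖ := by rw [h1]; exact le_abs_self _
        _ ≤ ‖J‖ * ‖S.predualEmbed j f‖ := J.le_opNorm _
        _ ≤ ‖J‖ * 1 := by
          gcongr
          exact (S.norm_predualEmbed_apply_le j f).trans hf
        _ = ‖J‖ := mul_one _

/-- Pulled back to the dual of `W i`, the functional is evaluation at some `w i` by reflexivity;
these vectors are compatible and bounded by `‖φ‖`. -/
theorem toPredualDual_surjective : Function.Surjective S.toPredualDual := by
  intro φ
  choose w hw using fun i => FiniteDimensional.inclusionInDoubleDual_surjective (S.W i)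
    (φ.comp (S.predualEmbed i))
  have hw' : ∀ i (f : StrongDual ℝ (S.W i)), f (w i) = φ (S.predualEmbed i f) := fun i f =>
    DFunLike.congr_fun (hw i) f
  have hbond : ∀ i, S.bond i (w (i + 1)) = w i := fun i => by
    rw [SeparatingDual.eq_iff_forall_dual_eq (R := ℝ)]
    intro f
    rw [hw', ← predualEmbed_bond, ← hw', ContinuousLinearMap.comp_apply]
  have hbound : ∀ i, ‖w i‖ ≤ ‖φ‖ := fun i => by
    refine NormedSpace.norm_le_dual_bound ℝ _ (norm_nonneg φ) fun f => ?_
    rw [hw']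
    exact (φ.le_opNorm _).trans
      (mul_le_mul_of_nonneg_left (S.norm_predualEmbed_apply_le i f) (norm_nonneg φ))
  exact ⟨(⟨w, hbond, ‖φ‖, hbound⟩ : S.boundedThreads), S.predual_dual_ext hw'⟩

/-- The inverse limit is the dual of its predual. -/
noncomputable def equivPredualDual : S.InvLim ≃ₗᵢ[ℝ] StrongDual ℝ S.Predual :=
  LinearIsometryEquiv.ofSurjective S.toPredualDual S.toPredualDual_surjective

end StandardInverseSystem

/-- A good finite dimensional approximation is a separable dual space. -/
theorem IsGFDA.isSeparableDualSpace {S : StandardInverseSystem.{u}} {V : Submodule ℝ S.InvLim}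
    (h : IsGFDA S V) : IsSeparableDualSpace V := by
  refine ⟨h.determining.separableSpace, S.Predual, inferInstance, inferInstance,
    inferInstance, ⟨?_⟩⟩
  exact (LinearIsometryEquiv.ofTop _ V h.eq_top).trans S.equivPredualDual

/-! ### GFDAs from the Kadec-Klee property -/

section Annihilators

variable {U : Type u} [NormedAddCommGroup U] [NormedSpace ℝ U] (φ : ℕ → StrongDual ℝ U)

/-- The common kernel of the first `i` functionals of a sequence. -/
def commonKer (i : ℕ) : Submodule ℝ U :=
  LinearMap.ker (ContinuousLinearMap.pi fun j : Fin i => φ j).toLinearMap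

theorem mem_commonKer {i : ℕ} {u : U} : u ∈ commonKer φ i ↔ ∀ j < i, φ j u = 0 := by
  rw [commonKer, LinearMap.mem_ker]
  exact ⟨fun h j hj => congrFun h ⟨j, hj⟩, fun h => funext fun j => h j j.2⟩

theorem commonKer_succ_le (i : ℕ) : commonKer φ (i + 1) ≤ commonKer φ i := fun _ hu =>
  (mem_commonKer φ).2 fun j hj => (mem_commonKer φ).1 hu j (hj.trans i.lt_succ_self)

instance isClosed_commonKer (i : ℕ) : IsClosed (commonKer φ i : Set U) :=
  (ContinuousLinearMap.pi fun j : Fin i => φ j).isClosed_ker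

instance finiteDimensional_quotient_commonKer (i : ℕ) :
    FiniteDimensional ℝ (U ⧸ commonKer φ i) :=
  Module.Finite.equiv
    (ContinuousLinearMap.pi fun j : Fin i => φ j).toLinearMap.quotKerEquivRange.symm

/-- The inverse system of the quotients by the common kernels of finitely many functionals. -/
noncomputable def quotientSystem : StandardInverseSystem.{u} where
  W i := U ⧸ commonKer φ i
  bond i := LinearMap.mkContinuous
    (Submodule.factor (commonKer_succ_le φ i)) 1 fun x => by
      rw [one_mul]
      refine le_of_forall_pos_le_add fun ε hε => ?_
      obtain ⟨u, rfl, hu⟩ := Submodule.Quotient.norm_mk_lt x hε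
      exact (Submodule.Quotient.norm_mk_le _ u).trans hu.le
  norm_bond_le i := LinearMap.mkContinuous_norm_le _ zero_le_one _

/-- The thread of the classes of a vector. -/
def quotientThread : U →ₗ[ℝ] (quotientSystem φ).InvLim where
  toFun u := (⟨fun i => (commonKer φ i).mkQ u, fun _ => rfl, ‖u‖, fun i =>
    Submodule.Quotient.norm_mk_le (commonKer φ i) u⟩ : (quotientSystem φ).boundedThreads)
  map_add' _ _ := rfl
  map_smul' _ _ := rfl

/-- Convergence in a quotient implies convergence against the functionals that factor through it. -/
theorem tendsto_apply_of_tendsto_mkQ {v : ℕ → U} {i j : ℕ} (hj : j < i) {w : U}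
    (hw : Tendsto (fun k => (commonKer φ i).mkQ (v k)) atTop (𝓝 ((commonKer φ i).mkQ w))) :
    Tendsto (fun k => φ j (v k)) atTop (𝓝 (φ j w)) := by
  let ψ : (U ⧸ commonKer φ i) →ₗ[ℝ] ℝ := (commonKer φ i).liftQ (φ j).toLinearMap
    fun _ hu => (mem_commonKer φ).1 hu j hj
  exact (ψ.continuous_of_finiteDimensional.tendsto _).comp hw

/-- A Banach space with a sequence of functionals for which balls are closed and sequentially
compact, and which has the Kadec-Klee property for convergence against these functionals, admits a
good finite dimensional approximation. -/
theorem admitsGFDA_of_kadecKlee [CompleteSpace U]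
    (hlsc : ∀ (v : ℕ → U) (u : U) (c : ℝ), (∀ k, ‖v k‖ ≤ c) →
      (∀ j, Tendsto (fun k => φ j (v k)) atTop (𝓝 (φ j u))) → ‖u‖ ≤ c)
    (hcpt : ∀ (v : ℕ → U) (c : ℝ), (∀ k, ‖v k‖ ≤ c) →
      (∀ j, ∃ a, Tendsto (fun k => φ j (v k)) atTop (𝓝 a)) →
      ∃ u, ∀ j, Tendsto (fun k => φ j (v k)) atTop (𝓝 (φ j u)))
    (hkk : ∀ (v : ℕ → U) (u : U), (∀ j, Tendsto (fun k => φ j (v k)) atTop (𝓝 (φ j u))) →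
      Tendsto (fun k => ‖v k‖) atTop (𝓝 ‖u‖) → Tendsto v atTop (𝓝 u)) :
    AdmitsGFDA U := by
  have hnorm : ∀ u, ‖quotientThread φ u‖ = ‖u‖ := by
    intro u
    refine le_antisymm (le_of_tendsto' (quotientThread φ u).tendsto_norm_entry fun j =>
      Submodule.Quotient.norm_mk_le (commonKer φ j) u) ?_
    refine le_of_forall_pos_le_add fun ε hε => ?_
    -- Near-minimal lifts `v k` of the entries of `u` agree with `u` on `φ j` once `k > j`, so lower
    -- semicontinuity bounds `‖u‖`.
    choose v hv hvn using fun k => Submodule.Quotient.norm_mk_lt ((commonKer φ k).mkQ u) hε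
    refine hlsc v u _ (fun k => ?_) fun j => ?_
    · exact (hvn k).le.trans
        (add_le_add ((quotientThread φ u).norm_entry_le k) le_rfl)
    · refine tendsto_const_nhds.congr' ?_
      filter_upwards [eventually_gt_atTop j] with k hk
      have h1 : v k - u ∈ commonKer φ k := (Submodule.Quotient.eq _).1 (hv k)
      have h2 := (mem_commonKer φ).1 h1 j hk
      rw [map_sub, sub_eq_zero] at h2
      exact h2.symm
  let ι : U →ₗᵢ[ℝ] (quotientSystem φ).InvLim := ⟨quotientThread φ, hnorm⟩
  refine ⟨quotientSystem φ, LinearMap.range ι.toLinearMap, ⟨?_, ?_, ?_⟩, ⟨ι.equivRange⟩⟩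
  · exact ι.isometry.isClosedEmbedding.isClosed_range
  · intro v hv hconv hbdd hunif
    choose x hx using hv
    obtain ⟨C, hC⟩ := hbdd
    have hxv : ∀ k, ‖x k‖ = ‖v k‖ := fun k => by rw [← hx k]; exact (hnorm (x k)).symm
    have hmk : ∀ j k, (quotientSystem φ).proj j (v k) = (commonKer φ j).mkQ (x k) := fun j k => by
      rw [← hx k]; rfl
    simp only [hmk] at hconv
    choose w hw using hconv
    choose y hy using fun j => (commonKer φ j).mkQ_surjective (w j)
    simp only [← hy] at hw
    obtain ⟨u, hu⟩ := hcpt x C (fun k => (hxv k).trans_le (hC k)) fun j =>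
      ⟨_, tendsto_apply_of_tendsto_mkQ φ j.lt_succ_self (hw (j + 1))⟩
    -- The limits in the quotients were lifted independently; they are all classes of the single
    -- vector `u`.
    have hyu : ∀ j, (commonKer φ j).mkQ (y j) = (commonKer φ j).mkQ u := fun j => by
      refine (Submodule.Quotient.eq _).2 ((mem_commonKer φ).2 fun i hi => ?_)
      rw [map_sub, sub_eq_zero]
      exact tendsto_nhds_unique (tendsto_apply_of_tendsto_mkQ φ hi (hw j)) (hu i)
    simp only [hyu] at hw
    have hlim : Tendsto (fun k => ‖x k‖) atTop (𝓝 ‖u‖) := by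
      rw [← hnorm u]
      simp only [hxv]
      -- Uniformity in `k` permits exchanging the limits in `j` and `k`.
      refine hunif.tendsto_of_eventually_tendsto (Eventually.of_forall fun j => ?_)
        (quotientThread φ u).tendsto_norm_entry
      simp only [hmk]
      exact (hw j).norm
    have hvι : v = fun k => ι (x k) := funext fun k => (hx k).symm
    exact ⟨ι u, hvι ▸ (ι.continuous.tendsto u).comp (hkk x u hu hlim)⟩
  · intro i
    refine ⟨fun y => ?_, fun y => ?_⟩
    · obtain ⟨u, rfl⟩ := (commonKer φ i).mkQ_surjective y
      exact ⟨⟨ι u, u, rfl⟩, rfl⟩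
    · refine ⟨?_, fun b hb => ?_⟩
      · rintro _ ⟨⟨_, u, rfl⟩, rfl, rfl⟩
        exact (StandardInverseSystem.InvLim.norm_entry_le (ι u) i)
      · refine le_of_forall_pos_le_add fun ε hε => ?_
        obtain ⟨u, rfl, hu⟩ := Submodule.Quotient.norm_mk_lt y hε
        exact (hb ⟨⟨ι u, u, rfl⟩, rfl, hnorm u⟩).trans hu.le

end Annihilators

/-! ### Equivalent norms -/

section Renorming

variable {E : Type u} [NormedAddCommGroup E] [NormedSpace ℝ E]

/-- A copy of the vector space `E`, to be normed by the seminorm `p`. -/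
def Renormed (_p : Seminorm ℝ E) : Type u := E

variable (p : Seminorm ℝ E)

instance : AddCommGroup (Renormed p) := inferInstanceAs (AddCommGroup E)
instance : Module ℝ (Renormed p) := inferInstanceAs (Module ℝ E)
instance : Norm (Renormed p) := ⟨fun x => p (show E from x)⟩

/-- A seminorm that is equivalent to the norm is the norm of a linearly homeomorphic space. -/
theorem Seminorm.exists_renorming {C : ℝ} (h₁ : ∀ x, ‖x‖ ≤ p x) (h₂ : ∀ x, p x ≤ C * ‖x‖) :
    ∃ (U : Type u) (_ : NormedAddCommGroup U) (_ : NormedSpace ℝ U) (e : E ≃L[ℝ] U),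
      ∀ x, ‖e x‖ = p x := by
  have core : NormedSpace.Core ℝ (Renormed p) :=
    { norm_nonneg := fun x => apply_nonneg p (show E from x)
      norm_smul := fun c x => map_smul_eq_mul p c (show E from x)
      norm_triangle := fun x y => map_add_le_add p (show E from x) (show E from y)
      norm_eq_zero_iff := fun x => ⟨fun h => norm_le_zero_iff.1
        ((h₁ (show E from x)).trans (le_of_eq h)), fun h => by rw [h]; exact map_zero p⟩ }
  let i₁ : NormedAddCommGroup (Renormed p) := NormedAddCommGroup.ofCore core
  let i₂ : NormedSpace ℝ (Renormed p) := NormedSpace.ofCore core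
  let L : E ≃ₗ[ℝ] Renormed p := LinearEquiv.refl ℝ E
  exact ⟨Renormed p, i₁, i₂, L.toContinuousLinearEquivOfBounds C 1 h₂
    (fun x => (h₁ x).trans (one_mul _).ge), fun _ => rfl⟩

end Renorming

/-! ### Semicontinuity of series -/

section Sums

variable {ι : Type*} {l : Filter ι}

/-- Lower semicontinuity of sums of nonnegative series. -/
theorem eventually_lt_tsum {g : ι → ℕ → ℝ} {h : ℕ → ℝ} (hg0 : ∀ k n, 0 ≤ g k n)
    (hg : ∀ k, Summable (g k)) (hh : Summable h)
    (hlsc : ∀ n, ∀ a < h n, ∀ᶠ k in l, a < g k n) {a : ℝ} (ha : a < ∑' n, h n) :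
    ∀ᶠ k in l, a < ∑' n, g k n := by
  obtain ⟨s, hs⟩ := (hh.hasSum.eventually (lt_mem_nhds ha)).exists
  -- Losing `δ` in each of the `s.card` terms still leaves `δ` to spare above `a`; the `+ 1` also
  -- covers empty `s`.
  have hδ : 0 < (∑ n ∈ s, h n - a) / (s.card + 1) :=
    div_pos (sub_pos.2 hs) (by positivity)
  set δ := (∑ n ∈ s, h n - a) / (s.card + 1) with hδ_def
  have hδs : δ * (s.card + 1) = ∑ n ∈ s, h n - a := div_mul_cancel₀ _ (by positivity)
  have hev : ∀ᶠ k in l, ∀ n ∈ s, h n - δ < g k n :=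
    (eventually_all_finset s).2 fun n _ => hlsc n _ (sub_lt_self _ hδ)
  filter_upwards [hev] with k hk
  have h1 : ∑ n ∈ s, (h n - δ) ≤ ∑ n ∈ s, g k n := Finset.sum_le_sum fun n hn => (hk n hn).le
  have h2 : ∑ n ∈ s, g k n ≤ ∑' n, g k n := (hg k).sum_le_tsum s fun n _ => hg0 k n
  rw [Finset.sum_sub_distrib, Finset.sum_const, nsmul_eq_mul] at h1
  linarith

/-- If the sums of nonnegative lower semicontinuous series converge, the terms are also upper
semicontinuous. -/
theorem eventually_lt_of_tendsto_tsum {g : ι → ℕ → ℝ} {h : ℕ → ℝ} (hg0 : ∀ k n, 0 ≤ g k n)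
    (hg : ∀ k, Summable (g k)) (hh : Summable h)
    (hlsc : ∀ n, ∀ a < h n, ∀ᶠ k in l, a < g k n)
    (hsum : Tendsto (fun k => ∑' n, g k n) l (𝓝 (∑' n, h n))) (n : ℕ) {b : ℝ} (hb : h n < b) :
    ∀ᶠ k in l, g k n < b := by
  have hsplit : ∀ f : ℕ → ℝ, Summable f →
      ∑' m, f m = f n + ∑' m, ({n}ᶜ : Set ℕ).indicator f m := fun f hf => by
    rw [hf.tsum_eq_add_tsum_ite n]
    congr 2
    funext m
    by_cases hm : m = n <;> simp [Set.indicator, hm]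
  -- The series without its `n`-th term can drop by at most half of `b - h n`, and the full sum can
  -- rise by at most the other half.
  have hrest := eventually_lt_tsum (l := l) (g := fun k => ({n}ᶜ : Set ℕ).indicator (g k))
    (h := ({n}ᶜ : Set ℕ).indicator h) (fun k m => Set.indicator_nonneg (fun m _ => hg0 k m) m)
    (fun k => (hg k).indicator _) (hh.indicator _) (fun m a ha => by
      by_cases hm : m = n
      · simp only [Set.indicator, Set.mem_compl_iff, Set.mem_singleton_iff, hm, not_true_eq_false,
          if_false] at ha ⊢
        exact Eventually.of_forall fun _ => ha
      · simp only [Set.indicator, Set.mem_compl_iff, Set.mem_singleton_iff, hm, not_false_eq_true,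
          if_true] at ha ⊢
        exact hlsc m a ha)
    (sub_lt_self _ (half_pos (sub_pos.2 hb)))
  filter_upwards [hrest, hsum.eventually (gt_mem_nhds
    (lt_add_of_pos_right _ (half_pos (sub_pos.2 hb))))] with k h1 h2
  rw [hsplit h hh, hsplit (g k) (hg k)] at h2
  linarith

end Sums

/-! ### Bounded pointwise convergence in a dual space -/

section WeakStar

variable {X : Type*} [NormedAddCommGroup X] [NormedSpace ℝ X] {ι : Type*}

/-- A normed space with separable dual is the closed span of a sequence. -/
theorem exists_seq_dense_span [TopologicalSpace.SeparableSpace (StrongDual ℝ X)] :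
    ∃ x : ℕ → X, (Submodule.span ℝ (Set.range x)).topologicalClosure = ⊤ := by
  let f := TopologicalSpace.denseSeq (StrongDual ℝ X)
  have hx : ∀ n, ∃ x : X, ‖x‖ ≤ 1 ∧ ‖f n‖ / 2 ≤ ‖f n x‖ := by
    intro n
    rcases eq_or_ne (f n) 0 with h | h
    · exact ⟨0, by simp, by simp [h]⟩
    · obtain ⟨x, hx, hlt⟩ := (f n).exists_lt_apply_of_lt_opNorm
        (half_lt_self (norm_pos_iff.2 h))
      exact ⟨x, hx.le, hlt.le⟩
  choose x hx1 hx2 using hx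
  refine ⟨x, ?_⟩
  by_contra hne
  obtain ⟨y, -, hy⟩ := SetLike.exists_of_lt (lt_top_iff_ne_top.2 hne)
  obtain ⟨g, a, hg1, hg2⟩ := geometric_hahn_banach_closed_point
    (Submodule.span ℝ (Set.range x)).topologicalClosure.convex
    (Submodule.isClosed_topologicalClosure _) hy
  -- A functional bounded above on a subspace vanishes there: otherwise some multiple of `z` attains
  -- the strict bound `a`.
  have hg0 : ∀ z ∈ Submodule.span ℝ (Set.range x), g z = 0 := by
    intro z hz
    by_contra hgz
    have h := hg1 ((a / g z) • z)
      (Submodule.smul_mem _ _ (Submodule.le_topologicalClosure _ hz))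
    rw [map_smul, smul_eq_mul, div_mul_cancel₀ _ hgz] at h
    exact lt_irrefl _ h
  have hgne : 0 < ‖g‖ := by
    rw [norm_pos_iff]
    rintro rfl
    have h := hg1 0 (Submodule.zero_mem _)
    exact lt_asymm h hg2
  obtain ⟨n, hn⟩ := (TopologicalSpace.denseRange_denseSeq (StrongDual ℝ X)).exists_dist_lt g
    (show 0 < ‖g‖ / 4 by positivity)
  have h1 : ‖g - f n‖ < ‖g‖ / 4 := by rwa [← dist_eq_norm]
  -- As `g` kills `x n`, this gives `‖f n‖ / 2 < ‖g‖ / 4`, against `‖f n‖ > 3 * ‖g‖ / 4`.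
  have h2 : ‖f n (x n)‖ ≤ ‖g - f n‖ := by
    have h := (g - f n).le_of_opNorm_le_of_le le_rfl (hx1 n)
    rwa [sub_apply, hg0 _ (Submodule.subset_span ⟨n, rfl⟩), zero_sub,
      norm_neg, mul_one] at h
  have h3 := norm_sub_norm_le g (f n)
  linarith [hx2 n]

/-- The norm of the dual is lower semicontinuous for pointwise convergence. -/
theorem norm_le_of_tendsto_apply {l : Filter ι} [l.NeBot] {f : ι → StrongDual ℝ X}
    {g : StrongDual ℝ X} (hfg : ∀ x, Tendsto (fun k => f k x) l (𝓝 (g x))) {c : ℝ} (hc : 0 ≤ c)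
    (hf : ∀ᶠ k in l, ‖f k‖ ≤ c) : ‖g‖ ≤ c := by
  refine g.opNorm_le_bound hc fun x => le_of_tendsto (hfg x).norm ?_
  filter_upwards [hf] with k hk
  exact (f k).le_of_opNorm_le hk x

/-- Pointwise convergence of a bounded family can be tested on a set with dense span. -/
theorem tendsto_apply_of_dense_span {l : Filter ι} {x : ℕ → X}
    (hx : (Submodule.span ℝ (Set.range x)).topologicalClosure = ⊤) {f : ι → StrongDual ℝ X}
    {g : StrongDual ℝ X} {C : ℝ} (hC : ∀ᶠ k in l, ‖f k‖ ≤ C)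
    (h : ∀ j, Tendsto (fun k => f k (x j)) l (𝓝 (g (x j)))) (y : X) :
    Tendsto (fun k => f k y) l (𝓝 (g y)) := by
  have hspan : ∀ z ∈ Submodule.span ℝ (Set.range x), Tendsto (fun k => f k z) l (𝓝 (g z)) := by
    intro z hz
    induction hz using Submodule.span_induction with
    | mem z hz => obtain ⟨j, rfl⟩ := hz; exact h j
    | zero => simpa using tendsto_const_nhds
    | add a b _ _ ha hb => simpa using ha.add hb
    | smul c a _ ha => simpa using ha.const_mul c
  rw [Metric.tendsto_nhds]
  intro ε hε
  have hM : 0 < |C| + ‖g‖ + 1 := by positivity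
  have hy : y ∈ closure (Submodule.span ℝ (Set.range x) : Set X) := by
    have : y ∈ (Submodule.span ℝ (Set.range x)).topologicalClosure := hx ▸ Submodule.mem_top
    exact this
  obtain ⟨z, hz, hyz⟩ := Metric.mem_closure_iff.1 hy (ε / 2 / (|C| + ‖g‖ + 1))
    (div_pos (half_pos hε) hM)
  rw [lt_div_iff₀ hM, dist_eq_norm] at hyz
  filter_upwards [hC, Metric.tendsto_nhds.1 (hspan z hz) (ε / 2) (half_pos hε)] with k hk hkz
  rw [Real.dist_eq] at hkz ⊢
  have h1 : |f k (y - z)| ≤ |C| * ‖y - z‖ :=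
    (f k).le_of_opNorm_le (hk.trans (le_abs_self C)) (y - z)
  have h2 : |g (y - z)| ≤ ‖g‖ * ‖y - z‖ := g.le_opNorm (y - z)
  have h3 : f k y - g y = f k (y - z) - g (y - z) + (f k z - g z) := by
    rw [map_sub, map_sub]; ring
  rw [h3]
  refine (abs_add_le _ _).trans_lt ?_
  have h4 := abs_sub (f k (y - z)) (g (y - z))
  nlinarith [norm_nonneg (y - z)]

/-- A bounded family of functionals has a pointwise limit along every ultrafilter. -/
theorem Ultrafilter.exists_tendsto_apply (𝒰 : Ultrafilter ι) {f : ι → StrongDual ℝ X} {C : ℝ}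
    (hf : ∀ k, ‖f k‖ ≤ C) :
    ∃ g : StrongDual ℝ X, ∀ x, Tendsto (fun k => f k x) 𝒰 (𝓝 (g x)) := by
  let F : ι → WeakDual ℝ X := fun k => StrongDual.toWeakDual (f k)
  obtain ⟨g, -, hg⟩ := (WeakDual.isCompact_closedBall (0 : StrongDual ℝ X) C).ultrafilter_le_nhds
    (𝒰.map F) (le_principal_iff.2 (Eventually.of_forall (f := (𝒰 : Filter ι)) fun k => by
      simpa [F] using hf k))
  exact ⟨WeakDual.toStrongDual g, fun x => ((WeakDual.eval_continuous x).tendsto g).comp hg⟩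

/-- If bounded functionals converge pointwise along an ultrafilter and are `c`-close to a finite
dimensional subspace, then so is the limit, and the convergence is in norm up to `2 * c`. -/
theorem Ultrafilter.norm_mkQ_le_and_eventually_norm_sub_lt (𝒰 : Ultrafilter ι)
    {f : ι → StrongDual ℝ X} {g : StrongDual ℝ X} {C : ℝ} (hf : ∀ᶠ k in 𝒰, ‖f k‖ ≤ C)
    (hfg : ∀ x, Tendsto (fun k => f k x) 𝒰 (𝓝 (g x)))
    (F : Submodule ℝ (StrongDual ℝ X)) [FiniteDimensional ℝ F] {c : ℝ}
    (hc : ∀ᶠ k in 𝒰, ‖F.mkQ (f k)‖ < c) :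
    ‖F.mkQ g‖ ≤ c ∧ ∀ δ > 0, ∀ᶠ k in 𝒰, ‖f k - g‖ < 2 * c + δ := by
  have hc0 : 0 ≤ c := by
    obtain ⟨k, hk⟩ := hc.exists
    exact (norm_nonneg (F.mkQ (f k))).trans hk.le
  have hlift : ∀ k, ∃ e : F, ‖F.mkQ (f k)‖ < c → ‖f k - e‖ < c := by
    intro k
    by_cases hk : ‖F.mkQ (f k)‖ < c
    · obtain ⟨m, hm, hmc⟩ := Submodule.Quotient.norm_mk_lt (F.mkQ (f k)) (sub_pos.2 hk)
      refine ⟨⟨f k - m, (Submodule.Quotient.eq F).1 hm.symm⟩, fun _ => ?_⟩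
      simpa using hmc
    · exact ⟨0, fun h => absurd h hk⟩
  choose e he using hlift
  have : ProperSpace F := FiniteDimensional.proper_real F
  -- The approximants are bounded in a finite dimensional space, so they converge in norm along `𝒰`.
  have hball : ∀ᶠ k in 𝒰, e k ∈ Metric.closedBall (0 : F) (C + c) := by
    filter_upwards [hf, hc] with k hk hkc
    change dist (e k : StrongDual ℝ X) 0 ≤ C + c
    rw [dist_zero_right]
    calc ‖(e k : StrongDual ℝ X)‖ = ‖f k - (f k - e k)‖ := by rw [sub_sub_cancel]
      _ ≤ ‖f k‖ + ‖f k - e k‖ := norm_sub_le _ _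
      _ ≤ C + c := add_le_add hk (he k hkc).le
  obtain ⟨e₀, -, he₀⟩ := (isCompact_closedBall (0 : F) (C + c)).ultrafilter_le_nhds (𝒰.map e)
    (le_principal_iff.2 hball)
  have he₀' : Tendsto e 𝒰 (𝓝 e₀) := he₀
  have hlim : Tendsto (fun k => (e k : StrongDual ℝ X)) 𝒰 (𝓝 (e₀ : StrongDual ℝ X)) :=
    (continuous_subtype_val.tendsto e₀).comp he₀'
  have hg : ‖g - (e₀ : StrongDual ℝ X)‖ ≤ c := by
    refine norm_le_of_tendsto_apply (l := (𝒰 : Filter ι))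
      (f := fun k => f k - (e k : StrongDual ℝ X))
      (fun x => (hfg x).sub ?_) hc0 (hc.mono fun k hk => (he k hk).le)
    exact ((ContinuousLinearMap.apply ℝ ℝ x).continuous.tendsto _).comp hlim
  refine ⟨?_, fun δ hδ => ?_⟩
  · have h1 : F.mkQ g = F.mkQ (g - e₀) := by
      rw [map_sub, (Submodule.Quotient.mk_eq_zero F).2 e₀.2 |> fun h => (h : F.mkQ e₀ = 0),
        sub_zero]
    rw [h1]
    exact (Submodule.Quotient.norm_mk_le F _).trans hg
  · filter_upwards [hc, Metric.tendsto_nhds.1 hlim δ hδ] with k hk hkδ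
    rw [dist_eq_norm] at hkδ
    calc ‖f k - g‖ = ‖(f k - e k) + ((e k : StrongDual ℝ X) - e₀) - (g - e₀)‖ := by
          congr 1; abel
      _ ≤ ‖(f k - e k) + ((e k : StrongDual ℝ X) - e₀)‖ + ‖g - e₀‖ := norm_sub_le _ _
      _ ≤ ‖f k - e k‖ + ‖(e k : StrongDual ℝ X) - e₀‖ + ‖g - e₀‖ := by
          gcongr; exact norm_add_le _ _
      _ < 2 * c + δ := by linarith [he k hk]

/-- The distance to a finite dimensional subspace of the dual is lower semicontinuous for bounded
pointwise convergence. -/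
theorem eventually_lt_norm_mkQ {l : Filter ι} {f : ι → StrongDual ℝ X} {g : StrongDual ℝ X}
    {C : ℝ} (hf : ∀ᶠ k in l, ‖f k‖ ≤ C) (hfg : ∀ x, Tendsto (fun k => f k x) l (𝓝 (g x)))
    (F : Submodule ℝ (StrongDual ℝ X)) [FiniteDimensional ℝ F] {a : ℝ} (ha : a < ‖F.mkQ g‖) :
    ∀ᶠ k in l, a < ‖F.mkQ (f k)‖ := by
  refine mem_iff_ultrafilter.2 fun 𝒰 h𝒰 => ?_
  by_contra hcon
  obtain ⟨c, hac, hcg⟩ := exists_between ha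
  -- On an ultrafilter, failure of the bound means distances eventually at most `a`, hence below
  -- `c`; the limit would then be within `c` of `F`.
  have hle : ∀ᶠ k in 𝒰, ‖F.mkQ (f k)‖ < c :=
    (Ultrafilter.eventually_not.2 hcon).mono fun k hk => (not_lt.1 hk).trans_lt hac
  exact hcg.not_ge (𝒰.norm_mkQ_le_and_eventually_norm_sub_lt (h𝒰 hf)
    (fun x => (hfg x).mono_left h𝒰) F hle).1

end WeakStar

/-! ### The Kadec-Klee seminorm -/

section KadecKlee

variable {E : Type*} [NormedAddCommGroup E] [NormedSpace ℝ E]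

theorem summable_geometric_mul_norm_mkQ (F : ℕ → Submodule ℝ E) (x : E) :
    Summable fun n => (1 / 2 : ℝ) ^ n * ‖(F n).mkQ x‖ :=
  (summable_geometric_two.mul_right ‖x‖).of_nonneg_of_le (fun n => by positivity) fun n =>
    mul_le_mul_of_nonneg_left (Submodule.Quotient.norm_mk_le (F n) x) (by positivity)

/-- The weighted sum of the distances to a sequence of subspaces. -/
noncomputable def distSumSeminorm (F : ℕ → Submodule ℝ E) : Seminorm ℝ E :=
  Seminorm.of (fun x => ∑' n, (1 / 2 : ℝ) ^ n * ‖(F n).mkQ x‖)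
    (fun x y => by
      rw [← (summable_geometric_mul_norm_mkQ F x).tsum_add (summable_geometric_mul_norm_mkQ F y)]
      refine (summable_geometric_mul_norm_mkQ F _).tsum_le_tsum (fun n => ?_)
        ((summable_geometric_mul_norm_mkQ F x).add (summable_geometric_mul_norm_mkQ F y))
      rw [← mul_add, map_add]
      exact mul_le_mul_of_nonneg_left (norm_add_le _ _) (by positivity))
    (fun c x => by
      rw [← tsum_mul_left]
      congr 1
      funext n
      rw [map_smul, norm_smul, mul_left_comm])

theorem distSumSeminorm_le (F : ℕ → Submodule ℝ E) (x : E) : distSumSeminorm F x ≤ 2 * ‖x‖ := by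
  have h := (summable_geometric_mul_norm_mkQ F x).tsum_le_tsum (fun n =>
    mul_le_mul_of_nonneg_left (Submodule.Quotient.norm_mk_le (F n) x) (by positivity))
    (summable_geometric_two.mul_right ‖x‖)
  rwa [tsum_mul_right, tsum_geometric_two] at h

/-- The term `n = 0` is the whole norm, because the distance to the zero subspace is the norm. -/
theorem norm_le_distSumSeminorm {F : ℕ → Submodule ℝ E} (hF : F 0 = ⊥) (x : E) :
    ‖x‖ ≤ distSumSeminorm F x := by
  have h0 : ‖x‖ ≤ ‖(F 0).mkQ x‖ := by
    refine le_of_forall_pos_le_add fun ε hε => ?_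
    obtain ⟨m, hm, hmc⟩ := Submodule.Quotient.norm_mk_lt ((F 0).mkQ x) hε
    have h1 : m - x ∈ F 0 := (Submodule.Quotient.eq (F 0)).1 hm
    rw [hF, Submodule.mem_bot, sub_eq_zero] at h1
    exact h1 ▸ hmc.le
  have h1 := (summable_geometric_mul_norm_mkQ F x).le_tsum 0 fun n _ => by positivity
  rw [pow_zero, one_mul] at h1
  exact h0.trans h1

variable {X : Type*} [NormedAddCommGroup X] [NormedSpace ℝ X] {ι : Type*} {l : Filter ι}
  {f : ι → StrongDual ℝ X} {g : StrongDual ℝ X} {C : ℝ} {F : ℕ → Submodule ℝ (StrongDual ℝ X)}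
  [∀ n, FiniteDimensional ℝ (F n)]

theorem eventually_lt_geometric_mul_norm_mkQ (hf : ∀ᶠ k in l, ‖f k‖ ≤ C)
    (hfg : ∀ x, Tendsto (fun k => f k x) l (𝓝 (g x))) (n : ℕ) {a : ℝ}
    (ha : a < (1 / 2 : ℝ) ^ n * ‖(F n).mkQ g‖) :
    ∀ᶠ k in l, a < (1 / 2 : ℝ) ^ n * ‖(F n).mkQ (f k)‖ := by
  have hpos : (0 : ℝ) < (1 / 2) ^ n := by positivity
  filter_upwards [eventually_lt_norm_mkQ hf hfg (F n) ((div_lt_iff₀' hpos).2 ha)] with k hk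
  exact (div_lt_iff₀' hpos).1 hk

/-- The sum of the distances to finite dimensional subspaces is lower semicontinuous for bounded
pointwise convergence. -/
theorem distSumSeminorm_le_of_tendsto_apply [l.NeBot] (hf : ∀ᶠ k in l, ‖f k‖ ≤ C)
    (hfg : ∀ x, Tendsto (fun k => f k x) l (𝓝 (g x))) {c : ℝ}
    (hc : ∀ᶠ k in l, distSumSeminorm F (f k) ≤ c) : distSumSeminorm F g ≤ c := by
  by_contra! hlt
  obtain ⟨k, hk, hkc⟩ := ((eventually_lt_tsum (fun k n => by positivity)
    (fun k => summable_geometric_mul_norm_mkQ F (f k)) (summable_geometric_mul_norm_mkQ F g)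
    (fun n _ => eventually_lt_geometric_mul_norm_mkQ hf hfg n) hlt).and hc).exists
  exact hk.not_ge hkc

/-- The Kadec-Klee property: bounded pointwise convergence together with convergence of the sums of
the distances to finite dimensional subspaces with dense union implies norm convergence. -/
theorem tendsto_of_tendsto_distSumSeminorm
    (hF : ∀ h : StrongDual ℝ X, ∀ ε > 0, ∃ n, ‖(F n).mkQ h‖ < ε)
    (hf : ∀ᶠ k in l, ‖f k‖ ≤ C) (hfg : ∀ x, Tendsto (fun k => f k x) l (𝓝 (g x)))
    (hp : Tendsto (fun k => distSumSeminorm F (f k)) l (𝓝 (distSumSeminorm F g))) :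
    Tendsto f l (𝓝 g) := by
  rw [Metric.tendsto_nhds]
  intro ε hε
  obtain ⟨n, hn⟩ := hF g (ε / 3) (by positivity)
  have hpos : (0 : ℝ) < (1 / 2) ^ n := by positivity
  have hev : ∀ᶠ k in l, ‖(F n).mkQ (f k)‖ < ε / 3 := by
    filter_upwards [eventually_lt_of_tendsto_tsum (fun k n => by positivity)
      (fun k => summable_geometric_mul_norm_mkQ F (f k)) (summable_geometric_mul_norm_mkQ F g)
      (fun n _ => eventually_lt_geometric_mul_norm_mkQ hf hfg n) hp n
      (mul_lt_mul_of_pos_left hn hpos)] with k hk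
    exact lt_of_mul_lt_mul_left hk hpos.le
  -- With distance bound `ε / 3` and `δ = ε / 3`, the error `2 * c + δ` is exactly `ε`.
  refine mem_iff_ultrafilter.2 fun 𝒰 h𝒰 => ?_
  filter_upwards [(𝒰.norm_mkQ_le_and_eventually_norm_sub_lt (h𝒰 hf)
    (fun x => (hfg x).mono_left h𝒰) (F n) (h𝒰 hev)).2 (ε / 3) (by positivity)] with k hk
  rw [dist_eq_norm]
  linarith

end KadecKlee

/-! ### Renorming a separable dual, and the main theorem -/

/-- In a separable space there are finite dimensional subspaces, starting with zero, that come
arbitrarily close to every vector. -/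
theorem exists_finiteDimensional_seq_dense (E : Type*) [NormedAddCommGroup E] [NormedSpace ℝ E]
    [TopologicalSpace.SeparableSpace E] :
    ∃ F : ℕ → Submodule ℝ E, F 0 = ⊥ ∧ (∀ n, FiniteDimensional ℝ (F n)) ∧
      ∀ x : E, ∀ ε > 0, ∃ n, ‖(F n).mkQ x‖ < ε := by
  let d := TopologicalSpace.denseSeq E
  refine ⟨fun n => Submodule.span ℝ (d '' Set.Iio n), by simp, fun n =>
    FiniteDimensional.span_of_finite ℝ ((Set.finite_Iio n).image d), fun x ε hε => ?_⟩
  obtain ⟨n, hn⟩ := (TopologicalSpace.denseRange_denseSeq E).exists_dist_lt x hε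
  refine ⟨n + 1, lt_of_le_of_lt ?_ hn⟩
  have hmem : d n ∈ Submodule.span ℝ (d '' Set.Iio (n + 1)) :=
    Submodule.subset_span ⟨n, n.lt_succ_self, rfl⟩
  have h1 : (Submodule.span ℝ (d '' Set.Iio (n + 1))).mkQ x =
      (Submodule.span ℝ (d '' Set.Iio (n + 1))).mkQ (x - d n) := by
    refine (Submodule.Quotient.eq _).2 ?_
    rwa [sub_sub_cancel]
  rw [h1, dist_eq_norm]
  exact Submodule.Quotient.norm_mk_le _ _

/-- A separable dual space is isomorphic to a space that admits a good finite dimensional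
approximation. -/
theorem IsSeparableDualSpace.exists_admitsGFDA {D : Type u} [NormedAddCommGroup D]
    [NormedSpace ℝ D] (hD : IsSeparableDualSpace D) :
    ∃ (U : Type u) (_ : NormedAddCommGroup U) (_ : NormedSpace ℝ U) (_ : CompleteSpace U),
      AdmitsGFDA U ∧ Nonempty (D ≃L[ℝ] U) := by
  obtain ⟨hsep, X, _, _, _, ⟨e₀⟩⟩ := hD
  have : TopologicalSpace.SeparableSpace (StrongDual ℝ X) :=
    e₀.surjective.denseRange.separableSpace e₀.continuous
  obtain ⟨x, hx⟩ := exists_seq_dense_span (X := X)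
  obtain ⟨F, hF0, _, hF⟩ := exists_finiteDimensional_seq_dense (StrongDual ℝ X)
  obtain ⟨U, _, _, e, he⟩ := (distSumSeminorm F).exists_renorming (norm_le_distSumSeminorm hF0)
    (distSumSeminorm_le F)
  have hU : CompleteSpace U :=
    (completeSpace_congr (e := e.toEquiv) e.isUniformEmbedding).1 inferInstance
  have hsymm : ∀ u, distSumSeminorm F (e.symm u) = ‖u‖ := fun u => by
    rw [← he, e.apply_symm_apply]
  have hle : ∀ u, ‖e.symm u‖ ≤ ‖u‖ := fun u =>
    (norm_le_distSumSeminorm hF0 _).trans_eq (hsymm u)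
  let φ : ℕ → StrongDual ℝ U := fun j =>
    (NormedSpace.inclusionInDoubleDual ℝ X (x j)).comp e.symm.toContinuousLinearMap
  refine ⟨U, inferInstance, inferInstance, hU, admitsGFDA_of_kadecKlee φ ?_ ?_ ?_,
    ⟨e₀.toContinuousLinearEquiv.trans e⟩⟩
  · intro v u c hv hvu
    have hb : ∀ᶠ k in atTop, ‖e.symm (v k)‖ ≤ c :=
      Eventually.of_forall fun k => (hle _).trans (hv k)
    rw [← hsymm]
    exact distSumSeminorm_le_of_tendsto_apply hb (tendsto_apply_of_dense_span hx hb hvu)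
      (Eventually.of_forall fun k => (hsymm _).trans_le (hv k))
  · intro v c hv hconv
    -- Compactness gives a limit only along an ultrafilter, but the scalar sequences are assumed
    -- convergent, so their full limits agree with it.
    obtain ⟨g, hg⟩ := (Ultrafilter.of (atTop : Filter ℕ)).exists_tendsto_apply
      (f := fun k => e.symm (v k)) fun k => (hle _).trans (hv k)
    refine ⟨e g, fun j => ?_⟩
    obtain ⟨a, ha⟩ := hconv j
    have h1 : a = φ j (e g) := by
      refine tendsto_nhds_unique (ha.mono_left (Ultrafilter.of_le atTop)) ?_
      have h2 : φ j (e g) = g (x j) := congrArg (fun h : StrongDual ℝ X => h (x j))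
        (e.symm_apply_apply g)
      rw [h2]
      exact hg (x j)
    exact h1 ▸ ha
  · intro v u hvu hn
    have hb : ∀ᶠ k in atTop, ‖e.symm (v k)‖ ≤ ‖u‖ + 1 :=
      (hn.eventually (gt_mem_nhds (lt_add_one ‖u‖))).mono fun k hk => (hle _).trans hk.le
    have hlim : Tendsto (fun k => e.symm (v k)) atTop (𝓝 (e.symm u)) := by
      refine tendsto_of_tendsto_distSumSeminorm hF hb (tendsto_apply_of_dense_span hx hb hvu) ?_
      simpa only [hsymm] using hn
    simpa [Function.comp_def] using (e.continuous.tendsto (e.symm u)).comp hlim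

theorem mainTheorem6 :
    -- a GFDA is the whole inverse limit, and it is a separable dual space
    (∀ (S : StandardInverseSystem.{u}) (V : Submodule ℝ S.InvLim),
      IsGFDA S V → V = ⊤ ∧ IsSeparableDualSpace V) ∧
    -- every separable dual space is isomorphic to a Banach space that admits a GFDA
    (∀ (D : Type u) [NormedAddCommGroup D] [NormedSpace ℝ D], IsSeparableDualSpace D →
      ∃ (U : Type u) (_ : NormedAddCommGroup U) (_ : NormedSpace ℝ U) (_ : CompleteSpace U),
        AdmitsGFDA U ∧ Nonempty (D ≃L[ℝ] U)) ∧
    -- up to isomorphism, the Banach spaces that admit a GFDA are the separable dual spaces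
    (∀ (B : Type u) [NormedAddCommGroup B] [NormedSpace ℝ B] [CompleteSpace B],
      (∃ (U : Type u) (_ : NormedAddCommGroup U) (_ : NormedSpace ℝ U) (_ : CompleteSpace U),
        AdmitsGFDA U ∧ Nonempty (B ≃L[ℝ] U)) ↔
      ∃ (D : Type u) (_ : NormedAddCommGroup D) (_ : NormedSpace ℝ D),
        IsSeparableDualSpace D ∧ Nonempty (B ≃L[ℝ] D)) := by
  refine ⟨fun S V h => ⟨h.eq_top, h.isSeparableDualSpace⟩, fun D _ _ hD => hD.exists_admitsGFDA,
    fun B _ _ _ => ⟨?_, ?_⟩⟩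
  · rintro ⟨U, _, _, _, ⟨S, V, hV, ⟨i⟩⟩, ⟨e⟩⟩
    exact ⟨V, inferInstance, inferInstance, hV.isSeparableDualSpace,
      ⟨e.trans i.toContinuousLinearEquiv⟩⟩
  · rintro ⟨D, _, _, hD, ⟨e⟩⟩
    obtain ⟨U, _, _, hU, hGFDA, ⟨e'⟩⟩ := hD.exists_admitsGFDA
    exact ⟨U, inferInstance, inferInstance, hU, hGFDA, ⟨e.trans e'⟩⟩
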